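/- Let $p$ be a prime, let $F$ be the free group on two generators $x,y$, and let $(\lambda_n(F))_{n\ge 1}$ be its $p$-central series, given by $\lambda_1(F)=F$ and $\lambda_n(F)=[\lambda_{n-1}(F),F]\,\lambda_{n-1}(F)^p$ for $n>1$, where $H^p$ denotes the subgroup generated by all $p$-th powers of elements of $H$. For elements $a,b$ of a group $G$ let $\Sigma(a,b)$ be the union of all subgroups of $G$ conjugate to $\langle a\rangle$, $\langle b\rangle$ or $\langle ab\rangle$. Two generating sets $\{x_1,y_1\}$, $\{x_2,y_2\}$ of $G$ form a Beauville structure for $G$ if $\Sigma(x_1,y_1)\cap\Sigma(x_2,y_2)=1$, and $G$ is a Beauville group if it is finite, its minimal number of generators is exactly two, and it has a Beauville structure. Then, for every $n\ge 1$, the $p$-central quotient $F/\lambda_n(F)$ is a Beauville group if and only if $p\ge 5$ and $n\ge 2$. Moreover, if $p\ge 5$ and $n\ge 3$, and $u$ and $v$ denote the images of $x$ and $y$ in $F/\lambda_n(F)$, then $\{u,v\}$ and $\{uv^2,uv^4\}$ form a Beauville structure for $F/\lambda_n(F)$. -/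

import Mathlib

/-- The subgroup `H ^ p` generated by all powers `h ^ p` with `h ∈ H`. -/
def powerSubgroup {G : Type*} [Group G] (H : Subgroup G) (p : ℕ) : Subgroup G :=
  Subgroup.closure {g : G | ∃ h ∈ H, h ^ p = g}

instance powerSubgroup_normal {G : Type*} [Group G] (H : Subgroup G) [hH : H.Normal] (p : ℕ) :
    (powerSubgroup H p).Normal := by
  refine ⟨fun x hx g => ?_⟩
  have hle : powerSubgroup H p ≤ (powerSubgroup H p).comap (MulAut.conj g).toMonoidHom := by
    refine (Subgroup.closure_le _).2 ?_
    rintro _ ⟨h, hh, rfl⟩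
    exact Subgroup.subset_closure ⟨g * h * g⁻¹, hH.conj_mem h hh g, conj_pow⟩
  exact hle hx

/-- The `p`-central series, indexed from `1`: `λ₁(G) = G` and
`λₙ(G) = [λₙ₋₁(G), G] λₙ₋₁(G) ^ p` for `n > 1` (the product of two normal subgroups is their
supremum). The value at index `0` is a dummy. -/
def pCentralSeries (G : Type*) [Group G] (p : ℕ) : ℕ → Subgroup G
  | 0 => ⊤
  | 1 => ⊤
  | n + 2 => ⁅pCentralSeries G p (n + 1), (⊤ : Subgroup G)⁆ ⊔
      powerSubgroup (pCentralSeries G p (n + 1)) p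

instance pCentralSeries_normal (G : Type*) [Group G] (p : ℕ) :
    ∀ n : ℕ, (pCentralSeries G p n).Normal
  | 0 => by unfold pCentralSeries; infer_instance
  | 1 => by unfold pCentralSeries; infer_instance
  | n + 2 => by
      have := pCentralSeries_normal G p (n + 1)
      unfold pCentralSeries
      infer_instance

/-- The conjugate subgroup `H ^ g = g⁻¹ H g`. -/
def conjSubgroup {G : Type*} [Group G] (H : Subgroup G) (g : G) : Subgroup G :=
  H.map (MulAut.conj g⁻¹).toMonoidHom

/-- `Σ(x, y)`: the union of all conjugates of `⟨x⟩`, `⟨y⟩` and `⟨xy⟩`. -/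
def beauvilleSigma {G : Type*} [Group G] (x y : G) : Set G :=
  ⋃ g : G, ((conjSubgroup (Subgroup.zpowers x) g : Set G) ∪
    (conjSubgroup (Subgroup.zpowers y) g : Set G) ∪
    (conjSubgroup (Subgroup.zpowers (x * y)) g : Set G))

/-- `{x₁, y₁}` and `{x₂, y₂}` form a Beauville structure for `G`: both sets generate `G`, and
`Σ(x₁, y₁) ∩ Σ(x₂, y₂) = 1`. -/
structure IsBeauvilleStructure {G : Type*} [Group G] (x₁ y₁ x₂ y₂ : G) : Prop where
  generates₁ : Subgroup.closure {x₁, y₁} = (⊤ : Subgroup G)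
  generates₂ : Subgroup.closure {x₂, y₂} = (⊤ : Subgroup G)
  inter_eq : beauvilleSigma x₁ y₁ ∩ beauvilleSigma x₂ y₂ = {1}

/-- The minimal number of generators of `G` is exactly two: some pair of elements generates `G`,
but no single element does (in particular `G` is not trivial). -/
def IsTwoGenerator (G : Type*) [Group G] : Prop :=
  (∃ x y : G, Subgroup.closure {x, y} = (⊤ : Subgroup G)) ∧ ¬ IsCyclic G

/-- Beauville groups: finite `2`-generator groups that have a Beauville structure. -/
structure IsBeauvilleGroup (G : Type*) [Group G] : Prop where
  finite : Finite G
  twoGenerator : IsTwoGenerator G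
  exists_structure : ∃ x₁ y₁ x₂ y₂ : G, IsBeauvilleStructure x₁ y₁ x₂ y₂

/-- The `p`-central quotient `F / λₙ(F)` of the free group `F` on two generators. -/
abbrev FreePCentralQuotient (p n : ℕ) : Type :=
  FreeGroup (Fin 2) ⧸ pCentralSeries (FreeGroup (Fin 2)) p n

/-- The image in `F / λₙ(F)` of the free generator of `F` with index `i`. -/
def freePCentralGen (p n : ℕ) (i : Fin 2) : FreePCentralQuotient p n :=
  QuotientGroup.mk (FreeGroup.of i)

/-! Everything is decided in the abelianization `ℤ²` modulo `p`. Exponent sums of elements of `λₘ₊₁`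
are divisible by `p ^ m`, while `w ^ p ^ m` lies in `λₘ₊₁`; so an element nonzero modulo `p` has
order exactly `p ^ (m + 1)` in `F / λₘ₊₂`, and its `p ^ m`-th power depends only on its exponent
sums modulo `p`. Hence two such cyclic subgroups meet trivially, even up to conjugacy, exactly when
the generators are independent modulo `p` (`mk_zpow_eq_one_of_conj_eq`,
`exists_zpow_eq_zpow_ne_one`). A generating pair `a, b` gives three distinct points `a`, `b`, `a +
b` of the projective line over `𝔽ₚ`, and a Beauville structure is two disjoint triples. With `p + 1`
points this needs `p ≥ 5`; the given pairs have slopes `0, ∞, 1` and `2, 4, 3`. -/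

section PCentralSeries

/-! ### Power maps, exponent sums and finiteness along the series. -/

open scoped commutatorElement

variable {G : Type*} [Group G] {p : ℕ}

lemma commutator_pCentralSeries_le (m : ℕ) :
    ⁅pCentralSeries G p (m + 1), (⊤ : Subgroup G)⁆ ≤ pCentralSeries G p (m + 2) := by
  rw [pCentralSeries]
  exact le_sup_left

lemma pow_mem_pCentralSeries_succ {m : ℕ} {w : G} (hw : w ∈ pCentralSeries G p (m + 1)) :
    w ^ p ∈ pCentralSeries G p (m + 2) := by
  rw [pCentralSeries]
  exact Subgroup.mem_sup_right (Subgroup.subset_closure ⟨w, hw, rfl⟩)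

lemma pCentralSeries_succ_le (m : ℕ) :
    pCentralSeries G p (m + 2) ≤ pCentralSeries G p (m + 1) := by
  rw [pCentralSeries]
  refine sup_le (Subgroup.commutator_le_left _ _) ((Subgroup.closure_le _).2 ?_)
  rintro _ ⟨h, hh, rfl⟩
  exact Subgroup.pow_mem _ hh p

lemma pow_prime_pow_mem_pCentralSeries (w : G) (m : ℕ) :
    w ^ p ^ m ∈ pCentralSeries G p (m + 1) := by
  induction m with
  | zero => exact Subgroup.mem_top _
  | succ m ih =>
    rw [pow_succ, pow_mul]
    exact pow_mem_pCentralSeries_succ ih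

/-- Elements of `λₘ₊₁` become central modulo `λₘ₊₂`. -/
lemma commute_mk_of_mem_pCentralSeries {m : ℕ} {w : G} (hw : w ∈ pCentralSeries G p (m + 1))
    (x : G) : Commute (x : G ⧸ pCentralSeries G p (m + 2)) (w : G ⧸ pCentralSeries G p (m + 2)) := by
  have h : ⁅w, x⁆ ∈ pCentralSeries G p (m + 2) :=
    commutator_pCentralSeries_le m (Subgroup.commutator_mem_commutator hw (Subgroup.mem_top x))
  have h' : ⁅(w : G ⧸ pCentralSeries G p (m + 2)), (x : G ⧸ pCentralSeries G p (m + 2))⁆ = 1 :=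
    (QuotientGroup.eq_one_iff _).2 h
  exact (commutatorElement_eq_one_iff_commute.1 h').symm

/-- The `p`-th power map raises the level of a congruence modulo the `p`-central series. -/
lemma pow_inv_mul_pow_mem_pCentralSeries {m : ℕ} {x y : G}
    (h : x⁻¹ * y ∈ pCentralSeries G p (m + 1)) :
    (x ^ p)⁻¹ * y ^ p ∈ pCentralSeries G p (m + 2) := by
  obtain ⟨w, rfl⟩ : ∃ w, y = x * w := ⟨x⁻¹ * y, by group⟩
  rw [inv_mul_cancel_left] at h
  have hc := commute_mk_of_mem_pCentralSeries h x
  have hw : (w : G ⧸ pCentralSeries G p (m + 2)) ^ p = 1 :=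
    (QuotientGroup.eq_one_iff _).2 (pow_mem_pCentralSeries_succ h)
  rw [← QuotientGroup.eq, QuotientGroup.mk_pow, QuotientGroup.mk_pow, QuotientGroup.mk_mul,
    hc.mul_pow, hw, mul_one]

/-- Modulo `λₘ₊₂`, the power `x ^ p ^ m` depends only on `x` modulo `λ₂`. -/
lemma pow_prime_pow_inv_mul_mem_pCentralSeries {x y : G}
    (h : x⁻¹ * y ∈ pCentralSeries G p 2) (m : ℕ) :
    (x ^ p ^ m)⁻¹ * y ^ p ^ m ∈ pCentralSeries G p (m + 2) := by
  induction m with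
  | zero => simpa using h
  | succ m ih =>
    rw [pow_succ, pow_mul, pow_mul]
    exact pow_inv_mul_pow_mem_pCentralSeries ih

/-- Maps to `ℤ` kill commutators, so each step of the series only gains a factor `p`. -/
lemma prime_pow_dvd_of_mem_pCentralSeries (φ : G →* Multiplicative ℤ) (m : ℕ) :
    ∀ w ∈ pCentralSeries G p (m + 1), (p : ℤ) ^ m ∣ (φ w).toAdd := by
  induction m with
  | zero => simp
  | succ m ih =>
    have hle : pCentralSeries G p (m + 2) ≤
        (AddSubgroup.toSubgroup (AddSubgroup.zmultiples ((p : ℤ) ^ (m + 1)))).comap φ := by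
      rw [pCentralSeries]
      refine sup_le (Subgroup.commutator_le.2 fun x _ y _ => ?_) ((Subgroup.closure_le _).2 ?_)
      · have : φ ⁅x, y⁆ = 1 := by rw [map_commutatorElement, commutatorElement_eq_one_iff_mul_comm,
          mul_comm]
        rw [Subgroup.mem_comap, this]
        exact Subgroup.one_mem _
      · rintro _ ⟨h, hh, rfl⟩
        refine Int.mem_zmultiples_iff.2 ?_
        have := mul_dvd_mul_right (ih h hh) (p : ℤ)
        rw [map_pow, toAdd_pow, pow_succ, nsmul_eq_mul, mul_comm (p : ℤ) (φ h).toAdd]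
        exact this
    exact fun w hw => Int.mem_zmultiples_iff.1 (hle hw)

/-- Each factor of the series is abelian, of exponent dividing `p`, and finitely generated by
Schreier's lemma. -/
lemma finiteIndex_pCentralSeries [Group.FG G] (hp : 0 < p) (m : ℕ) :
    (pCentralSeries G p (m + 1)).FiniteIndex := by
  induction m with
  | zero => rw [zero_add, pCentralSeries]; infer_instance
  | succ m ih =>
    set L := pCentralSeries G p (m + 1) with hL
    set N := pCentralSeries G p (m + 2) with hN
    have hFG : Group.FG L := inferInstance
    let Q := L ⧸ N.subgroupOf L
    let _ : CommGroup Q :=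
      { (inferInstance : Group Q) with
        mul_comm := by
          rintro ⟨a⟩ ⟨b⟩
          refine QuotientGroup.eq.2 (Subgroup.mem_subgroupOf.2 ?_)
          have h := commutator_pCentralSeries_le (p := p) m (Subgroup.commutator_mem_commutator
            (L.inv_mem b.2) (Subgroup.mem_top (a : G)⁻¹))
          simpa [commutatorElement_def, mul_assoc] using h }
    have hQ : Group.FG Q := QuotientGroup.fg _
    have htors : IsMulTorsion Q := by
      rintro ⟨a⟩
      refine isOfFinOrder_iff_pow_eq_one.2 ⟨p, hp, (QuotientGroup.eq_one_iff (a ^ p)).2 ?_⟩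
      exact Subgroup.mem_subgroupOf.2 (pow_mem_pCentralSeries_succ a.2)
    have hfin : Finite Q := CommGroup.finite_of_fg_isMulTorsion Q htors
    have h1 : N.relIndex L ≠ 0 := by
      have : (N.subgroupOf L).FiniteIndex := Subgroup.finiteIndex_of_finite_quotient
      exact this.index_ne_zero
    refine ⟨?_⟩
    rw [← Subgroup.relIndex_mul_index (pCentralSeries_succ_le m)]
    exact mul_ne_zero h1 ih.index_ne_zero

end PCentralSeries

/-! ### Reduction to `𝔽ₚ²`. -/

section ExponentSum

/-- The sum of the exponents of the free generator with index `i`, as a homomorphism. -/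
def exponentSumHom (i : Fin 2) : FreeGroup (Fin 2) →* Multiplicative ℤ :=
  FreeGroup.lift fun j => Multiplicative.ofAdd (if j = i then 1 else 0)

def exponentSum (i : Fin 2) (w : FreeGroup (Fin 2)) : ℤ := (exponentSumHom i w).toAdd

@[simp] lemma exponentSum_of (i j : Fin 2) :
    exponentSum i (FreeGroup.of j) = if j = i then 1 else 0 := by
  simp [exponentSum, exponentSumHom]

@[simp] lemma exponentSum_mul (i : Fin 2) (v w : FreeGroup (Fin 2)) :
    exponentSum i (v * w) = exponentSum i v + exponentSum i w := by
  simp [exponentSum]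

@[simp] lemma exponentSum_one (i : Fin 2) : exponentSum i 1 = 0 := by
  simp [exponentSum]

@[simp] lemma exponentSum_inv (i : Fin 2) (w : FreeGroup (Fin 2)) :
    exponentSum i w⁻¹ = -exponentSum i w := by
  simp [exponentSum]

@[simp] lemma exponentSum_pow (i : Fin 2) (w : FreeGroup (Fin 2)) (k : ℕ) :
    exponentSum i (w ^ k) = k * exponentSum i w := by
  simp [exponentSum]

@[simp] lemma exponentSum_zpow (i : Fin 2) (w : FreeGroup (Fin 2)) (k : ℤ) :
    exponentSum i (w ^ k) = k * exponentSum i w := by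
  simp [exponentSum]

lemma prime_pow_dvd_exponentSum {p m : ℕ} {w : FreeGroup (Fin 2)}
    (hw : w ∈ pCentralSeries (FreeGroup (Fin 2)) p (m + 1)) (i : Fin 2) :
    (p : ℤ) ^ m ∣ exponentSum i w :=
  prime_pow_dvd_of_mem_pCentralSeries (exponentSumHom i) m w hw

/-- `F / λ₂` is abelian of exponent dividing `p`, so the class of `w` is read off from its exponent
sums. -/
lemma mem_pCentralSeries_two_of_dvd_exponentSum {p : ℕ} {w : FreeGroup (Fin 2)}
    (hw : ∀ i, (p : ℤ) ∣ exponentSum i w) : w ∈ pCentralSeries (FreeGroup (Fin 2)) p 2 := by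
  let q : FreeGroup (Fin 2) → FreePCentralQuotient p 2 := fun z => z
  have hcomm : ∀ a b : FreePCentralQuotient p 2, Commute a b := by
    rintro ⟨a⟩ ⟨b⟩
    exact commute_mk_of_mem_pCentralSeries (m := 0) (Subgroup.mem_top b) a
  have hpow : ∀ a : FreePCentralQuotient p 2, ∀ k : ℤ, (p : ℤ) ∣ k → a ^ k = 1 := by
    intro a _ ⟨k, hk⟩
    obtain ⟨a, rfl⟩ := QuotientGroup.mk_surjective a
    rw [hk, zpow_mul, zpow_natCast]
    have : q (a ^ p) = 1 :=
      (QuotientGroup.eq_one_iff _).2 (pow_mem_pCentralSeries_succ (m := 0) (Subgroup.mem_top a))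
    change q (a ^ p) ^ k = 1
    rw [this, one_zpow]
  have key : ∀ z, q z = freePCentralGen p 2 0 ^ exponentSum 0 z *
      freePCentralGen p 2 1 ^ exponentSum 1 z := by
    intro z
    induction z using FreeGroup.induction_on with
    | C1 => simp [q]
    | of j => fin_cases j <;> simp [q, freePCentralGen]
    | inv_of j h =>
      change (q (FreeGroup.of j))⁻¹ = _
      rw [h, mul_inv_rev, (hcomm _ _).eq, exponentSum_inv, exponentSum_inv, zpow_neg, zpow_neg]
    | mul a b ha hb =>
      change q a * q b = _
      rw [ha, hb, exponentSum_mul, exponentSum_mul, zpow_add, zpow_add,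
        (hcomm _ _).mul_mul_mul_comm]
  refine (QuotientGroup.eq_one_iff w).1 ((key w).trans ?_)
  rw [hpow _ _ (hw 0), hpow _ _ (hw 1), one_mul]

/-- The determinant of the images of two elements in the abelianization `ℤ²`. -/
def exponentDet (v w : FreeGroup (Fin 2)) : ℤ :=
  exponentSum 0 v * exponentSum 1 w - exponentSum 1 v * exponentSum 0 w

/-- A linear form over `𝔽ₚ` factors through `F / λₘ₊₂`, so if it vanishes on generators it is zero.
-/
lemma dvd_of_closure_eq_top {p m : ℕ} {x y : FreeGroup (Fin 2)}
    (h : Subgroup.closure {(x : FreePCentralQuotient p (m + 2)), (y : FreePCentralQuotient p (m + 2))}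
      = ⊤) (α β : ℤ)
    (hx : (p : ℤ) ∣ α * exponentSum 0 x + β * exponentSum 1 x)
    (hy : (p : ℤ) ∣ α * exponentSum 0 y + β * exponentSum 1 y) :
    (p : ℤ) ∣ α ∧ (p : ℤ) ∣ β := by
  let S : Subgroup (FreeGroup (Fin 2)) :=
    { carrier := {w | (p : ℤ) ∣ α * exponentSum 0 w + β * exponentSum 1 w}
      one_mem' := by simp
      mul_mem' := by
        intro a b ha hb
        obtain ⟨c, hc⟩ := ha
        obtain ⟨d, hd⟩ := hb
        exact ⟨c + d, by simp only [exponentSum_mul]; linear_combination hc + hd⟩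
      inv_mem' := by
        intro a ha
        obtain ⟨c, hc⟩ := ha
        exact ⟨-c, by simp only [exponentSum_inv]; linear_combination -hc⟩ }
  have hker : pCentralSeries (FreeGroup (Fin 2)) p (m + 2) ≤ S := fun w hw =>
    (dvd_pow_self (p : ℤ) m.succ_ne_zero).trans <|
      dvd_add ((prime_pow_dvd_exponentSum hw 0).mul_left α)
        ((prime_pow_dvd_exponentSum hw 1).mul_left β)
  have hmap : S.map (QuotientGroup.mk' (pCentralSeries (FreeGroup (Fin 2)) p (m + 2))) = ⊤ := by
    rw [eq_top_iff, ← h, Subgroup.closure_le]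
    rintro _ (rfl | rfl)
    · exact ⟨x, hx, rfl⟩
    · exact ⟨y, hy, rfl⟩
  have hS : ∀ w, w ∈ S := by
    intro w
    have hw : QuotientGroup.mk' (pCentralSeries (FreeGroup (Fin 2)) p (m + 2)) w ∈ S.map
      (QuotientGroup.mk' (pCentralSeries (FreeGroup (Fin 2)) p (m + 2))) := hmap ▸ Subgroup.mem_top _
    obtain ⟨s, hs, hsw⟩ := hw
    have := S.mul_mem hs (hker (QuotientGroup.eq.1 hsw))
    rwa [mul_inv_cancel_left] at this
  have h0 : (p : ℤ) ∣ _ := hS (FreeGroup.of 0)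
  have h1 : (p : ℤ) ∣ _ := hS (FreeGroup.of 1)
  exact ⟨by simpa using h0, by simpa using h1⟩

lemma not_dvd_exponentDet_of_closure_eq_top {p m : ℕ} (hp : p.Prime) {x y : FreeGroup (Fin 2)}
    (h : Subgroup.closure {(x : FreePCentralQuotient p (m + 2)), (y : FreePCentralQuotient p (m + 2))}
      = ⊤) : ¬ (p : ℤ) ∣ exponentDet x y := by
  intro hd
  rw [exponentDet] at hd
  have hx := dvd_of_closure_eq_top h (-exponentSum 1 x) (exponentSum 0 x)
    ⟨0, by ring⟩ (by convert hd using 1; ring)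
  have hy := dvd_of_closure_eq_top h (exponentSum 1 y) (-exponentSum 0 y)
    (by convert hd using 1; ring) ⟨0, by ring⟩
  -- The forms `det(x, ·)` and `det(·, y)` are zero, so the first coordinate vanishes on both
  -- generators.
  have h1 := (dvd_of_closure_eq_top h 1 0 (by simpa using hx.2) (by simpa using hy.2)).1
  exact hp.one_lt.ne' (by exact_mod_cast Int.eq_one_of_dvd_one (by positivity) h1)

end ExponentSum

/-! ### Intersections of cyclic subgroups and the projective line. -/

section Beauville

lemma mem_beauvilleSigma_iff {G : Type*} [Group G] {a b z : G} :
    z ∈ beauvilleSigma a b ↔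
      ∃ c, (c = a ∨ c = b ∨ c = a * b) ∧ ∃ (g : G) (k : ℤ), g⁻¹ * c ^ k * g = z := by
  have hconj : ∀ c g : G, z ∈ conjSubgroup (Subgroup.zpowers c) g ↔
      ∃ k : ℤ, g⁻¹ * c ^ k * g = z := by
    intro c g
    constructor
    · rintro ⟨_, ⟨k, rfl⟩, hk⟩
      exact ⟨k, by simpa using hk⟩
    · rintro ⟨k, hk⟩
      exact ⟨c ^ k, ⟨k, rfl⟩, by simpa using hk⟩
  simp only [beauvilleSigma, Set.mem_iUnion, Set.mem_union, SetLike.mem_coe, hconj]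
  constructor
  · rintro ⟨g, (⟨k, h⟩ | ⟨k, h⟩) | ⟨k, h⟩⟩
    · exact ⟨a, by simp, g, k, h⟩
    · exact ⟨b, by simp, g, k, h⟩
    · exact ⟨a * b, by simp, g, k, h⟩
  · rintro ⟨c, rfl | rfl | rfl, g, k, h⟩
    · exact ⟨g, Or.inl (Or.inl ⟨k, h⟩)⟩
    · exact ⟨g, Or.inl (Or.inr ⟨k, h⟩)⟩
    · exact ⟨g, Or.inr ⟨k, h⟩⟩

variable {p : ℕ}

/-- Elements independent modulo `p` in the abelianization have conjugates with trivially
intersecting cyclic subgroups in every `p`-central quotient. -/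
lemma mk_zpow_eq_one_of_conj_eq (hp : p.Prime) {m : ℕ} {a b g h : FreeGroup (Fin 2)} {k l : ℤ}
    (hd : ¬ (p : ℤ) ∣ exponentDet a b)
    (heq : ((g⁻¹ * a ^ k * g : FreeGroup (Fin 2)) : FreePCentralQuotient p (m + 1)) =
      ((h⁻¹ * b ^ l * h : FreeGroup (Fin 2)) : FreePCentralQuotient p (m + 1))) :
    ((a ^ k : FreeGroup (Fin 2)) : FreePCentralQuotient p (m + 1)) = 1 := by
  have hmem := QuotientGroup.eq.1 heq
  have h0 := prime_pow_dvd_exponentSum hmem 0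
  have h1 := prime_pow_dvd_exponentSum hmem 1
  simp only [exponentSum_mul, exponentSum_inv, exponentSum_zpow] at h0 h1
  have hk : (p : ℤ) ^ m ∣ k * exponentDet a b := by
    obtain ⟨c, hc⟩ := h0
    obtain ⟨d, hd⟩ := h1
    -- Cramer's rule eliminates `l`; conjugation does not affect exponent sums.
    refine ⟨exponentSum 0 b * d - exponentSum 1 b * c, ?_⟩
    rw [exponentDet]
    linear_combination exponentSum 0 b * hd - exponentSum 1 b * hc
  have hpZ : Prime (p : ℤ) := Nat.prime_iff_prime_int.1 hp
  obtain ⟨c, rfl⟩ := (IsCoprime.pow_left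
    ((hpZ.coprime_iff_not_dvd).2 hd)).dvd_of_dvd_mul_right hk
  refine (QuotientGroup.eq_one_iff _).2 ?_
  rw [zpow_mul]
  exact Subgroup.zpow_mem _ (by exact_mod_cast pow_prime_pow_mem_pCentralSeries a m) c

lemma closure_freePCentralGen (p n : ℕ) :
    Subgroup.closure {freePCentralGen p n 0, freePCentralGen p n 1} = ⊤ := by
  have h : Subgroup.closure (Set.range (FreeGroup.of : Fin 2 → _)) = ⊤ := FreeGroup.closure_range_of _
  have h2 := congrArg (Subgroup.map (QuotientGroup.mk' (pCentralSeries (FreeGroup (Fin 2)) p n))) h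
  rw [MonoidHom.map_closure, Subgroup.map_top_of_surjective _ (QuotientGroup.mk'_surjective _)] at h2
  rw [← h2]
  congr 1
  ext z
  simp [freePCentralGen, eq_comm]

lemma isBeauvilleStructure_freePCentralGen (hp : p.Prime) (hp5 : 5 ≤ p) (m : ℕ) :
    IsBeauvilleStructure (freePCentralGen p (m + 2) 0) (freePCentralGen p (m + 2) 1)
      (freePCentralGen p (m + 2) 0 * freePCentralGen p (m + 2) 1 ^ 2)
      (freePCentralGen p (m + 2) 0 * freePCentralGen p (m + 2) 1 ^ 4) := by
  set u := freePCentralGen p (m + 2) 0 with hu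
  set v := freePCentralGen p (m + 2) 1 with hv
  refine ⟨closure_freePCentralGen p _, ?_, ?_⟩
  · rw [eq_top_iff, ← closure_freePCentralGen p (m + 2), Subgroup.closure_le]
    set H := Subgroup.closure {u * v ^ 2, u * v ^ 4}
    have h2 : u * v ^ 2 ∈ H := Subgroup.subset_closure (by simp)
    have h4 : u * v ^ 4 ∈ H := Subgroup.subset_closure (by simp)
    have hv2 : v ^ 2 ∈ H := by
      have := H.mul_mem (H.inv_mem h2) h4
      convert this using 1
      group
    have hvp : v ^ p ^ (m + 1) = 1 :=
      (QuotientGroup.eq_one_iff _).2 (pow_prime_pow_mem_pCentralSeries (FreeGroup.of 1) (m + 1))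
    -- `v` has odd order, so `v = (v ^ 2) ^ (-k)`.
    obtain ⟨k, hk⟩ : Odd (p ^ (m + 1)) := (hp.odd_of_ne_two (by omega)).pow
    have hvH : v ∈ H := by
      have := H.inv_mem (H.pow_mem hv2 k)
      convert this using 1
      rw [← pow_mul, eq_comm, inv_eq_iff_mul_eq_one, ← pow_succ, ← hk, hvp]
    have huH : u ∈ H := by
      have := H.mul_mem h2 (H.inv_mem hv2)
      rwa [mul_inv_cancel_right] at this
    rintro _ (rfl | rfl)
    exacts [huH, hvH]
  · let x : FreeGroup (Fin 2) := FreeGroup.of 0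
    let y : FreeGroup (Fin 2) := FreeGroup.of 1
    refine Set.eq_singleton_iff_unique_mem.2 ⟨⟨?_, ?_⟩, ?_⟩
    · exact mem_beauvilleSigma_iff.2 ⟨u, by simp, 1, 0, by simp⟩
    · exact mem_beauvilleSigma_iff.2 ⟨u * v ^ 2, by simp, 1, 0, by simp⟩
    · rintro z ⟨hz1, hz2⟩
      obtain ⟨a, ha, g, k, hk⟩ := mem_beauvilleSigma_iff.1 hz1
      obtain ⟨g, rfl⟩ := QuotientGroup.mk_surjective g
      obtain ⟨b, hb, h, l, hl⟩ := mem_beauvilleSigma_iff.1 hz2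
      obtain ⟨h, rfl⟩ := QuotientGroup.mk_surjective h
      have hndvd : ∀ d : ℤ, d = 1 ∨ d = 2 ∨ d = 3 ∨ d = 4 → ¬ (p : ℤ) ∣ d := by
        intro d hd hpd
        have := Int.le_of_dvd (by omega) hpd
        omega
      obtain ⟨a', rfl, b', rfl, hdet⟩ : ∃ a' : FreeGroup (Fin 2),
          (a' : FreePCentralQuotient p (m + 2)) = a ∧ ∃ b' : FreeGroup (Fin 2),
          (b' : FreePCentralQuotient p (m + 2)) = b ∧ ¬ (p : ℤ) ∣ exponentDet a' b' := by
        have hpZ : Prime (p : ℤ) := Nat.prime_iff_prime_int.1 hp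
        -- The nine determinants are, up to sign, `1`, `2`, `3`, `4` and `6`; doubling covers `6 = 2
        -- * 3`.
        have hdvd4 : ∀ d e : ℤ, (e = 1 ∨ e = 2 ∨ e = 3 ∨ e = 4) → (d = e ∨ d = -e ∨ d = 2 * e ∨
            d = -(2 * e)) → ¬ (p : ℤ) ∣ d := by
          rintro d e he (rfl | rfl | rfl | rfl)
          · exact hndvd _ he
          · rw [dvd_neg]; exact hndvd _ he
          · exact hpZ.not_dvd_mul (hndvd 2 (by simp)) (hndvd _ he)
          · rw [dvd_neg]; exact hpZ.not_dvd_mul (hndvd 2 (by simp)) (hndvd _ he)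
        rcases ha with rfl | rfl | rfl <;> rcases hb with rfl | rfl | rfl
        · exact ⟨x, rfl, x * y ^ 2, rfl, hdvd4 _ 2 (by simp) (by simp [exponentDet, x, y])⟩
        · exact ⟨x, rfl, x * y ^ 4, rfl, hdvd4 _ 4 (by simp) (by simp [exponentDet, x, y])⟩
        · exact ⟨x, rfl, x * y ^ 2 * (x * y ^ 4), rfl,
            hdvd4 _ 3 (by simp) (by simp [exponentDet, x, y])⟩
        · exact ⟨y, rfl, x * y ^ 2, rfl, hdvd4 _ 1 (by simp) (by simp [exponentDet, x, y])⟩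
        · exact ⟨y, rfl, x * y ^ 4, rfl, hdvd4 _ 1 (by simp) (by simp [exponentDet, x, y])⟩
        · exact ⟨y, rfl, x * y ^ 2 * (x * y ^ 4), rfl,
            hdvd4 _ 1 (by simp) (by simp [exponentDet, x, y])⟩
        · exact ⟨x * y, rfl, x * y ^ 2, rfl, hdvd4 _ 1 (by simp) (by simp [exponentDet, x, y])⟩
        · exact ⟨x * y, rfl, x * y ^ 4, rfl, hdvd4 _ 3 (by simp) (by simp [exponentDet, x, y])⟩
        · exact ⟨x * y, rfl, x * y ^ 2 * (x * y ^ 4), rfl,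
            hdvd4 _ 2 (by simp) (by simp [exponentDet, x, y])⟩
      have key : ((a' ^ k : FreeGroup (Fin 2)) : FreePCentralQuotient p (m + 2)) = 1 :=
        mk_zpow_eq_one_of_conj_eq hp (g := g) (h := h) (l := l) hdet (hk.trans hl.symm)
      rw [QuotientGroup.mk_zpow] at key
      rw [← hk, key, mul_one, inv_mul_cancel]

lemma not_isCyclic_freePCentralQuotient (hp : p.Prime) (m : ℕ) :
    ¬ IsCyclic (FreePCentralQuotient p (m + 2)) := by
  rintro ⟨⟨w⟩, hw⟩
  refine not_dvd_exponentDet_of_closure_eq_top (m := m) hp (x := w) (y := w) ?_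
    ⟨0, by rw [exponentDet]; ring⟩
  rw [Set.pair_eq_singleton, ← Subgroup.zpowers_eq_closure]
  exact (Subgroup.eq_top_iff' _).2 hw

/-- If `e` and `f` are proportional and nonzero modulo `p`, then the cyclic subgroups they
generate in a `p`-central quotient intersect nontrivially. -/
lemma exists_zpow_eq_zpow_ne_one (hp : p.Prime) (m : ℕ) {e f : FreeGroup (Fin 2)}
    (he : ∃ i, ¬ (p : ℤ) ∣ exponentSum i e) (hf : ∃ i, ¬ (p : ℤ) ∣ exponentSum i f)
    (hdet : (p : ℤ) ∣ exponentDet e f) :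
    ∃ k l : ℤ, (e : FreePCentralQuotient p (m + 2)) ^ k = (f : FreePCentralQuotient p (m + 2)) ^ l ∧
      (e : FreePCentralQuotient p (m + 2)) ^ k ≠ 1 := by
  have hpZ : Prime (p : ℤ) := Nat.prime_iff_prime_int.1 hp
  obtain ⟨j, hj⟩ : ∃ j : ℤ, ∀ i, (p : ℤ) ∣ exponentSum i (e⁻¹ * f ^ j) := by
    simp only [exponentSum_mul, exponentSum_inv, exponentSum_zpow]
    obtain ⟨i₀, hi₀⟩ := hf
    obtain ⟨r, s, hrs⟩ := (hpZ.coprime_iff_not_dvd).2 hi₀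
    obtain ⟨d, hd⟩ := hdet
    rw [exponentDet] at hd
    have hall : ∀ i, (p : ℤ) ∣ exponentSum i₀ e * exponentSum i f -
        exponentSum i e * exponentSum i₀ f := by
      intro i
      match i, i₀ with
      | 0, 0 => exact ⟨0, by ring⟩
      | 0, 1 => exact ⟨-d, by linear_combination -hd⟩
      | 1, 0 => exact ⟨d, by linear_combination hd⟩
      | 1, 1 => exact ⟨0, by ring⟩
    -- `s` inverts the coordinate `i₀` of `f` modulo `p`, so this is the ratio of `e` to `f`.
    refine ⟨s * exponentSum i₀ e, fun i => ?_⟩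
    obtain ⟨c, hc⟩ := hall i
    exact ⟨s * c - r * exponentSum i e, by linear_combination s * hc + exponentSum i e * hrs⟩
  have hmem := pow_prime_pow_inv_mul_mem_pCentralSeries
    (mem_pCentralSeries_two_of_dvd_exponentSum hj) m
  refine ⟨(p ^ m : ℕ), j * (p ^ m : ℕ), ?_, ?_⟩
  · rw [zpow_mul, zpow_natCast, zpow_natCast]
    exact QuotientGroup.eq.2 hmem
  · rw [zpow_natCast]
    intro h1
    have h2 : e ^ p ^ m ∈ pCentralSeries (FreeGroup (Fin 2)) p (m + 2) :=
      (QuotientGroup.eq_one_iff _).1 h1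
    obtain ⟨i, hi⟩ := he
    have h3 := prime_pow_dvd_exponentSum h2 i
    rw [exponentSum_pow, Nat.cast_pow, pow_succ] at h3
    exact hi ((mul_dvd_mul_iff_left (pow_ne_zero m hpZ.ne_zero)).1 h3)

/-- For `p = 3` the only units are `±1`; for `p = 2` the hypotheses conflict. -/
lemma dvd_sub_of_not_dvd_of_lt_five (hp : p.Prime) (hp5 : p < 5) {s t : ℤ} (hs : ¬ (p : ℤ) ∣ s)
    (ht : ¬ (p : ℤ) ∣ t) (hst : ¬ (p : ℤ) ∣ s + t) : (p : ℤ) ∣ s - t := by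
  interval_cases p
  · exact absurd hp (by norm_num)
  · exact absurd hp (by norm_num)
  · omega
  · have h1 : s % 3 = 1 ∨ s % 3 = 2 := by omega
    have h2 : t % 3 = 1 ∨ t % 3 = 2 := by omega
    omega
  · exact absurd hp (by norm_num)

/-- For `p < 5` the projective line over `𝔽ₚ` has fewer than six points, so the triples attached to
two generating pairs share a point. -/
lemma exists_dvd_exponentDet_of_lt_five (hp : p.Prime) (hp5 : p < 5)
    {a b c d : FreeGroup (Fin 2)} (hab : ¬ (p : ℤ) ∣ exponentDet a b)
    (hcd : ¬ (p : ℤ) ∣ exponentDet c d) :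
    ∃ e f, (e = a ∨ e = b ∨ e = a * b) ∧ (f = c ∨ f = d ∨ f = c * d) ∧
      (p : ℤ) ∣ exponentDet e f := by
  by_contra! hne
  have hsub : ∀ f, (f = c ∨ f = d ∨ f = c * d) →
      (p : ℤ) ∣ exponentDet a f - exponentDet b f := by
    intro f hf
    refine dvd_sub_of_not_dvd_of_lt_five hp hp5 (hne a f (by simp) hf) (hne b f (by simp) hf) ?_
    have h := hne (a * b) f (by simp) hf
    convert h using 2
    simp only [exponentDet, exponentSum_mul]
    ring
  have hpZ : Prime (p : ℤ) := Nat.prime_iff_prime_int.1 hp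
  refine hpZ.not_dvd_mul hab hcd ?_
  -- `det(a - b, ·)` vanishes at `c` and `d`; the Plücker relation turns this combination into
  -- `det(a, b) * det(c, d)`.
  have := dvd_sub ((hsub c (by simp)).mul_right (exponentDet b d))
    ((hsub d (by simp)).mul_right (exponentDet b c))
  convert this using 1
  simp only [exponentDet]
  ring

lemma exists_not_dvd_exponentSum {a b e : FreeGroup (Fin 2)}
    (hab : ¬ (p : ℤ) ∣ exponentDet a b) (he : e = a ∨ e = b ∨ e = a * b) :
    ∃ i, ¬ (p : ℤ) ∣ exponentSum i e := by
  by_contra! hdvd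
  have h0 := hdvd 0
  have h1 := hdvd 1
  refine hab ?_
  rcases he with rfl | rfl | rfl
  · exact dvd_sub (h0.mul_right _) (h1.mul_right _)
  · exact dvd_sub (h1.mul_left _) (h0.mul_left _)
  · rw [exponentSum_mul] at h0 h1
    obtain ⟨c, hc⟩ := h0
    obtain ⟨d, hd⟩ := h1
    refine ⟨c * exponentSum 1 b - d * exponentSum 0 b, ?_⟩
    rw [exponentDet]
    linear_combination exponentSum 1 b * hc - exponentSum 0 b * hd

lemma not_isBeauvilleStructure_of_lt_five (hp : p.Prime) (hp5 : p < 5) (m : ℕ)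
    (x₁ y₁ x₂ y₂ : FreePCentralQuotient p (m + 2)) : ¬ IsBeauvilleStructure x₁ y₁ x₂ y₂ := by
  obtain ⟨a, rfl⟩ := QuotientGroup.mk_surjective x₁
  obtain ⟨b, rfl⟩ := QuotientGroup.mk_surjective y₁
  obtain ⟨c, rfl⟩ := QuotientGroup.mk_surjective x₂
  obtain ⟨d, rfl⟩ := QuotientGroup.mk_surjective y₂
  rintro ⟨h₁, h₂, hinter⟩
  have hab := not_dvd_exponentDet_of_closure_eq_top hp h₁
  have hcd := not_dvd_exponentDet_of_closure_eq_top hp h₂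
  obtain ⟨e, f, he, hf, hdet⟩ := exists_dvd_exponentDet_of_lt_five hp hp5 hab hcd
  obtain ⟨k, l, hkl, hne⟩ := exists_zpow_eq_zpow_ne_one hp m (exists_not_dvd_exponentSum hab he)
    (exists_not_dvd_exponentSum hcd hf) hdet
  refine hne (hinter.subset ⟨mem_beauvilleSigma_iff.2 ⟨e, ?_, 1, k, by simp⟩,
    mem_beauvilleSigma_iff.2 ⟨f, ?_, 1, l, by simp [hkl]⟩⟩)
  · rcases he with rfl | rfl | rfl <;> simp
  · rcases hf with rfl | rfl | rfl <;> simp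

end Beauville

theorem theoremA (p : ℕ) (hp : p.Prime) (n : ℕ) (hn : 1 ≤ n) :
    (IsBeauvilleGroup (FreePCentralQuotient p n) ↔ 5 ≤ p ∧ 2 ≤ n) ∧
    (5 ≤ p → 3 ≤ n → ∀ u v : FreePCentralQuotient p n,
      u = freePCentralGen p n 0 → v = freePCentralGen p n 1 →
      IsBeauvilleStructure u v (u * v ^ 2) (u * v ^ 4)) := by
  refine ⟨⟨fun h => ?_, fun h => ?_⟩, fun hp5 hn3 u v hu hv => ?_⟩
  · have hn2 : 2 ≤ n := by
      by_contra hlt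
      obtain rfl : n = 1 := by omega
      -- `F / λ₁` is trivial, hence cyclic.
      refine h.twoGenerator.2 ?_
      have : Subsingleton (FreePCentralQuotient p 1) := QuotientGroup.subsingleton_quotient_top
      infer_instance
    refine ⟨?_, hn2⟩
    obtain ⟨m, rfl⟩ := Nat.exists_eq_add_of_le' hn2
    obtain ⟨x₁, y₁, x₂, y₂, hs⟩ := h.exists_structure
    by_contra hlt
    exact not_isBeauvilleStructure_of_lt_five hp (by omega) m _ _ _ _ hs
  · obtain ⟨hp5, hn2⟩ := h
    obtain ⟨m, rfl⟩ := Nat.exists_eq_add_of_le' hn2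
    have := finiteIndex_pCentralSeries (G := FreeGroup (Fin 2)) hp.pos (m + 1)
    exact ⟨Subgroup.finite_quotient_of_finiteIndex,
      ⟨⟨_, _, closure_freePCentralGen p _⟩, not_isCyclic_freePCentralQuotient hp m⟩,
      _, _, _, _, isBeauvilleStructure_freePCentralGen hp hp5 m⟩
  · subst hu hv
    obtain ⟨m, rfl⟩ := Nat.exists_eq_add_of_le' (show 2 ≤ n by omega)
    exact isBeauvilleStructure_freePCentralGen hp hp5 m
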